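/- Let $\Sigma[1]$ be the free 2-cell, i.e. the strict 2-category with two objects $x,y$, whose hom-category from $x$ to $y$ is the ordinal $[1]=\{0<1\}$ (two 1-morphisms $f_0,f_1\colon x\to y$ and one non-identity 2-cell $f_0\Rightarrow f_1$), whose hom-category from $y$ to $x$ is empty, and whose endomorphism categories of $x$ and of $y$ are terminal. Let $N\Sigma[1]$ be its Duskin nerve: an $n$-simplex consists of objects $a_i$ ($0\le i\le n$), 1-morphisms $a_{ij}\colon a_i\to a_j$ ($i\le j$) with $a_{ii}=\mathrm{id}$, and 2-cells $a_{ik}\Rightarrow a_{jk}\circ a_{ij}$ ($i\le j\le k$), which are identities if $i=j$ or $j=k$ and satisfy the tetrahedron relation for all $i\le j\le k\le l$; simplicial operators act by restriction. Write $d_i$ and $s_i$ for its face and degeneracy maps. A functor $M\colon[k]\times[l]^{\mathrm{op}}\to[1]$ with $k,l\ge-1$ and $k+l=n-1$ (where $[-1]=\varnothing$) defines an $n$-simplex of $N\Sigma[1]$: its vertices $0,\dots,k$ are $x$, its vertices $k+1,\dots,n$ are $y$, its edge from vertex $i\le k$ to vertex $k+1+j$ is $f_{M(i,j)}$, its remaining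 edges are identities, and its 2-cells are the only possible ones. Then in every dimension $n\ge0$ the simplicial set $N\Sigma[1]$ has exactly two non-degenerate simplices $\sigma_n\neq\sigma_n'$. They are given by the following matrices: - for $n=2m$: $\sigma_{2m}$ by $[m-1]\times[m]^{\mathrm{op}}\to[1]$ with value $0$ at $(i,j)$ if $i<j$ and $1$ otherwise, and $\sigma'_{2m}$ by $[m]\times[m-1]^{\mathrm{op}}\to[1]$ with value $0$ at $(i,j)$ if $i\le j$ and $1$ otherwise; - for $n=2m+1$: $\sigma_{2m+1}$ by $[m]\times[m]^{\mathrm{op}}\to[1]$ with value $0$ at $(i,j)$ if $i<j$ and $1$ otherwise, and $\sigma'_{2m+1}$ by $[m]\times[m]^{\mathrm{op}}\to[1]$ with value $0$ at $(i,j)$ if $i\le j$ and $1$ otherwise. In particular $\sigma_0=y$, $\sigma'_0=x$, $\sigma_1=f_1$ and $\sigma'_1=f_0$. Moreover, for $n>1$ each of $\sigma_n,\sigma'_n$ is the unique $n$-simplex of $N\Sigma[1]$ that satisfies its relations in the following list ($m\ge1$): $$d_i\sigma_{2m}=\begin{cases}s_{m-1+i}\,\sigma_{2m-2}&0\le i\le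 m-1\\ \sigma'_{2m-1}&i=m\\ s_{i-m-1}\,\sigma_{2m-2}&m+1\le i\le 2m-1\\ \sigma_{2m-1}&i=2m\end{cases}\qquad d_i\sigma'_{2m}=\begin{cases}\sigma_{2m-1}&i=0\\ s_{m-1+i}\,\sigma'_{2m-2}&1\le i\le m-1\\ \sigma'_{2m-1}&i=m\\ s_{i-m-1}\,\sigma'_{2m-2}&m+1\le i\le 2m\end{cases}$$ $$d_i\sigma_{2m+1}=\begin{cases}s_{m+i}\,\sigma_{2m-1}&0\le i\le m-1\\ \sigma_{2m}&i=m\\ \sigma'_{2m}&i=m+1\\ s_{i-m-2}\,\sigma_{2m-1}&m+2\le i\le 2m+1\end{cases}\qquad d_i\sigma'_{2m+1}=\begin{cases}\sigma_{2m}&i=0\\ s_{m-1+i}\,\sigma'_{2m-1}&1\le i\le m\\ s_{i-m-1}\,\sigma'_{2m-1}&m+1\le i\le 2m\\ \sigma'_{2m}&i=2m+1\end{cases}$$ -/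

import Mathlib

open CategoryTheory

universe w v u

/-! ### Normal oplax diagrams and the Duskin nerve -/

namespace Duskin

open Bicategory

/-- A normalised oplax diagram of shape a preorder `I` in a strict 2-category `C`: an object for
each `i`, a 1-morphism for each `i ≤ j` (an identity for `i = j`), and a 2-cell
`map i k ⟶ map i j ≫ map j k` for each `i ≤ j ≤ k` (an identity for `i = j` and for `j = k`),
such that the four 2-cells attached to `i ≤ j ≤ k ≤ l` satisfy the tetrahedron relation. -/
@[ext]
structure Diagram (I : Type*) [Preorder I] (C : Type u) [Bicategory.{w, v} C]
    [Bicategory.Strict C] where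
  /-- the objects -/
  obj : I → C
  /-- the 1-morphisms -/
  map : ∀ i j : I, i ≤ j → (obj i ⟶ obj j)
  /-- the 2-cells -/
  cell : ∀ (i j k : I) (hij : i ≤ j) (hjk : j ≤ k),
    map i k (hij.trans hjk) ⟶ map i j hij ≫ map j k hjk
  map_self : ∀ i : I, map i i le_rfl = 𝟙 (obj i)
  cell_left : ∀ (i k : I) (h : i ≤ k),
    cell i i k le_rfl h = eqToHom (by rw [map_self, Bicategory.Strict.id_comp])
  cell_right : ∀ (i k : I) (h : i ≤ k),
    cell i k k h le_rfl = eqToHom (by rw [map_self, Bicategory.Strict.comp_id])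
  tetrahedron : ∀ (i j k l : I) (hij : i ≤ j) (hjk : j ≤ k) (hkl : k ≤ l),
    cell i k l (hij.trans hjk) hkl ≫ cell i j k hij hjk ▷ map k l hkl ≫
        eqToHom (Bicategory.Strict.assoc _ _ _) =
      cell i j l hij (hjk.trans hkl) ≫ map i j hij ◁ cell j k l hjk hkl

/-- Restriction of a diagram along a monotone map. -/
def Diagram.pullback {I J : Type*} [Preorder I] [Preorder J] {C : Type u} [Bicategory.{w, v} C]
    [Bicategory.Strict C] (s : Diagram J C) (φ : I →o J) : Diagram I C where
  obj i := s.obj (φ i)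
  map i j h := s.map (φ i) (φ j) (φ.monotone h)
  cell i j k hij hjk := s.cell (φ i) (φ j) (φ k) (φ.monotone hij) (φ.monotone hjk)
  map_self i := s.map_self (φ i)
  cell_left i k h := s.cell_left (φ i) (φ k) (φ.monotone h)
  cell_right i k h := s.cell_right (φ i) (φ k) (φ.monotone h)
  tetrahedron i j k l hij hjk hkl := s.tetrahedron (φ i) (φ j) (φ k) (φ l)
    (φ.monotone hij) (φ.monotone hjk) (φ.monotone hkl)

/-- The Duskin nerve of a strict 2-category `C`: its `n`-simplices are the normalised oplax
diagrams of shape `[n] = {0 < ⋯ < n}` in `C`, and simplicial operators act by restriction. -/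
def nerve (C : Type u) [Bicategory.{w, v} C] [Bicategory.Strict C] : SSet.{max u v w} where
  obj X := Diagram (Fin (X.unop.len + 1)) C
  map f := TypeCat.ofHom fun s => s.pullback f.unop.toOrderHom
  map_id _ := rfl
  map_comp _ _ := rfl

/-- The 0-simplex of the Duskin nerve given by an object. -/
def vertex {C : Type u} [Bicategory.{w, v} C] [Bicategory.Strict C] (a : C) : (nerve C).obj (.op (.mk 0)) :=
  show Diagram (Fin 1) C from
  { obj := fun _ => a
    map := fun _ _ _ => 𝟙 a
    cell := fun _ _ _ _ _ => eqToHom (Bicategory.Strict.id_comp _).symm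
    map_self := fun _ => rfl
    cell_left := fun _ _ _ => rfl
    cell_right := fun _ _ _ => rfl
    tetrahedron := by intros; simp }

/-- The objects of the 1-simplex given by a 1-morphism `a ⟶ b`. -/
def edgeObj {C : Type u} (a b : C) : Fin 2 → C
  | 0 => a
  | 1 => b

/-- The 1-morphisms of the 1-simplex given by a 1-morphism `f`. -/
def edgeMap {C : Type u} [Bicategory.{w, v} C] {a b : C} (f : a ⟶ b) :
    ∀ i j : Fin 2, i ≤ j → (edgeObj a b i ⟶ edgeObj a b j)
  | 0, 0, _ => 𝟙 a
  | 0, 1, _ => f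
  | 1, 1, _ => 𝟙 b
  | 1, 0, h => absurd h (by decide)

lemma edgeMap_comp {C : Type u} [Bicategory.{w, v} C] [Bicategory.Strict C] {a b : C} (f : a ⟶ b) :
    ∀ (i j k : Fin 2) (hij : i ≤ j) (hjk : j ≤ k),
      edgeMap f i k (hij.trans hjk) = edgeMap f i j hij ≫ edgeMap f j k hjk
  | 0, 0, 0, _, _ => (Bicategory.Strict.id_comp _).symm
  | 0, 0, 1, _, _ => (Bicategory.Strict.id_comp _).symm
  | 0, 1, 1, _, _ => (Bicategory.Strict.comp_id _).symm
  | 1, 1, 1, _, _ => (Bicategory.Strict.id_comp _).symm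
  | 1, 0, _, h, _ => absurd h (by decide)
  | 0, 1, 0, _, h => absurd h (by decide)
  | 1, 1, 0, _, h => absurd h (by decide)

/-- The 1-simplex of the Duskin nerve given by a 1-morphism. -/
def edge {C : Type u} [Bicategory.{w, v} C] [Bicategory.Strict C] {a b : C} (f : a ⟶ b) :
    (nerve C).obj (.op (.mk 1)) :=
  show Diagram (Fin 2) C from
  { obj := edgeObj a b
    map := edgeMap f
    cell := fun i j k hij hjk => eqToHom (edgeMap_comp f i j k hij hjk)
    map_self := fun i => match i with
      | 0 => rfl
      | 1 => rfl
    cell_left := fun _ _ _ => rfl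
    cell_right := fun _ _ _ => rfl
    tetrahedron := by intros; simp }

end Duskin

/-! ### The suspension of a category -/

/-- The two objects `x` and `y` of the suspension 2-category of `D`. -/
inductive Suspension (D : Type u) : Type
  | x : Suspension D
  | y : Suspension D

namespace Suspension

variable {D : Type u}

/-- The 1-morphisms of the suspension: `D` from `x` to `y`, nothing from `y` to `x`, and one
endomorphism of each object. -/
def Hom : Suspension D → Suspension D → Type u
  | x, x => PUnit
  | x, y => D
  | y, x => PEmpty
  | y, y => PUnit

/-- The identity 1-morphisms. -/
def id : ∀ a : Suspension D, Hom a a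
  | x => PUnit.unit
  | y => PUnit.unit

/-- Composition of 1-morphisms (one of the factors is always an identity). -/
def comp : ∀ {a b c : Suspension D}, Hom a b → Hom b c → Hom a c
  | x, x, x, _, _ => PUnit.unit
  | x, x, y, _, d => d
  | x, y, y, d, _ => d
  | y, y, y, _, _ => PUnit.unit
  | x, y, x, _, e => nomatch (show PEmpty from e)
  | y, x, _, e, _ => nomatch (show PEmpty from e)
  | y, y, x, _, e => nomatch (show PEmpty from e)

instance : CategoryStruct (Suspension D) where
  Hom := Hom
  id := id
  comp := comp

lemma id_comp' : ∀ {a b : Suspension D} (f : a ⟶ b), 𝟙 a ≫ f = f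
  | x, x, _ => rfl
  | x, y, _ => rfl
  | y, x, e => nomatch (show PEmpty from e)
  | y, y, _ => rfl

lemma comp_id' : ∀ {a b : Suspension D} (f : a ⟶ b), f ≫ 𝟙 b = f
  | x, x, _ => rfl
  | x, y, _ => rfl
  | y, x, e => nomatch (show PEmpty from e)
  | y, y, _ => rfl

lemma assoc' : ∀ {a b c d : Suspension D} (f : a ⟶ b) (g : b ⟶ c) (h : c ⟶ d),
    (f ≫ g) ≫ h = f ≫ g ≫ h
  | x, x, x, x, _, _, _ => rfl
  | x, x, x, y, _, _, _ => rfl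
  | x, x, y, y, _, _, _ => rfl
  | x, y, y, y, _, _, _ => rfl
  | y, y, y, y, _, _, _ => rfl
  | y, x, _, _, e, _, _ => nomatch (show PEmpty from e)
  | _, y, x, _, _, e, _ => nomatch (show PEmpty from e)
  | _, _, y, x, _, _, e => nomatch (show PEmpty from e)

variable [Category.{v} D]

/-- The 2-cells of the suspension: the morphisms of `D` between 1-morphisms from `x` to `y`, and
only identities elsewhere. -/
def Hom₂ : ∀ {a b : Suspension D}, Hom a b → Hom a b → Type v
  | x, x, _, _ => PUnit
  | x, y, d, e => (show D from d) ⟶ (show D from e)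
  | y, x, _, _ => PUnit
  | y, y, _, _ => PUnit

/-- The identity 2-cells. -/
def id₂ : ∀ {a b : Suspension D} (f : Hom a b), Hom₂ f f
  | x, x, _ => PUnit.unit
  | x, y, d => 𝟙 (show D from d)
  | y, x, _ => PUnit.unit
  | y, y, _ => PUnit.unit

/-- Vertical composition of 2-cells. -/
def comp₂ : ∀ {a b : Suspension D} {f g h : Hom a b}, Hom₂ f g → Hom₂ g h → Hom₂ f h
  | x, x, _, _, _, _, _ => PUnit.unit
  | x, y, f, g, h, η, θ =>
    (show (show D from f) ⟶ (show D from g) from η) ≫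
      (show (show D from g) ⟶ (show D from h) from θ)
  | y, x, _, _, _, _, _ => PUnit.unit
  | y, y, _, _, _, _, _ => PUnit.unit

instance homCategory (a b : Suspension D) : Category.{v} (a ⟶ b) where
  Hom := Hom₂ (a := a) (b := b)
  id := id₂
  comp := comp₂
  id_comp := by
    rcases a <;> rcases b <;> intros
    · rfl
    · exact Category.id_comp (obj := D) _
    · rfl
    · rfl
  comp_id := by
    rcases a <;> rcases b <;> intros
    · rfl
    · exact Category.comp_id (obj := D) _
    · rfl
    · rfl
  assoc := by
    rcases a <;> rcases b <;> intros
    · rfl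
    · exact Category.assoc (obj := D) _ _ _
    · rfl
    · rfl

/-- Left whiskering. -/
def wL : ∀ {a b c : Suspension D} (f : a ⟶ b) {g h : b ⟶ c}, (g ⟶ h) → (f ≫ g ⟶ f ≫ h)
  | x, x, x, _, _, _, _ => PUnit.unit
  | x, x, y, _, _, _, η => η
  | x, y, y, d, _, _, _ => 𝟙 (show D from d)
  | y, y, y, _, _, _, _ => PUnit.unit
  | x, y, x, _, e, _, _ => nomatch (show PEmpty from e)
  | y, x, _, e, _, _, _ => nomatch (show PEmpty from e)
  | y, y, x, _, e, _, _ => nomatch (show PEmpty from e)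

/-- Right whiskering. -/
def wR : ∀ {a b c : Suspension D} {f g : a ⟶ b}, (f ⟶ g) → ∀ h : b ⟶ c, (f ≫ h ⟶ g ≫ h)
  | x, x, x, _, _, _, _ => PUnit.unit
  | x, x, y, _, _, _, d => 𝟙 (show D from d)
  | x, y, y, _, _, η, _ => η
  | y, y, y, _, _, _, _ => PUnit.unit
  | x, y, x, _, _, _, e => nomatch (show PEmpty from e)
  | y, x, _, e, _, _, _ => nomatch (show PEmpty from e)
  | y, y, x, _, _, _, e => nomatch (show PEmpty from e)

lemma conj_id {d e : D} (η : d ⟶ e) : η = 𝟙 d ≫ η ≫ 𝟙 e := by simp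

/-- The suspension 2-category of the category `D`. -/
instance : Bicategory (Suspension D) where
  homCategory := homCategory
  whiskerLeft f _ _ η := wL f η
  whiskerRight η h := wR η h
  associator f g h := eqToIso (assoc' f g h)
  leftUnitor f := eqToIso (id_comp' f)
  rightUnitor f := eqToIso (comp_id' f)
  whiskerLeft_id := by
    rintro (_ | _) (_ | _) (_ | _) f g <;> rfl
  whiskerLeft_comp := by
    rintro (_ | _) (_ | _) (_ | _) f g h i η θ <;>
      first
      | rfl
      | exact (Category.id_comp (obj := D) _).symm
  id_whiskerLeft := by
    rintro (_ | _) (_ | _) f g η <;>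
      first
      | rfl
      | exact conj_id (D := D) η
  comp_whiskerLeft := by
    rintro (_ | _) (_ | _) (_ | _) (_ | _) f g h i η <;>
      first
      | rfl
      | exact conj_id (D := D) η
      | exact conj_id (D := D) (𝟙 _)
      | exact PEmpty.elim f
      | exact PEmpty.elim g
  id_whiskerRight := by
    rintro (_ | _) (_ | _) (_ | _) f g <;> rfl
  comp_whiskerRight := by
    rintro (_ | _) (_ | _) (_ | _) f g h η θ i <;>
      first
      | rfl
      | exact (Category.id_comp (obj := D) _).symm
  whiskerRight_id := by
    rintro (_ | _) (_ | _) f g η <;>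
      first
      | rfl
      | exact conj_id (D := D) η
  whiskerRight_comp := by
    rintro (_ | _) (_ | _) (_ | _) (_ | _) f f' η g h <;>
      first
      | rfl
      | exact conj_id (D := D) η
      | exact conj_id (D := D) (𝟙 _)
      | exact PEmpty.elim f
      | exact PEmpty.elim g
  whisker_assoc := by
    rintro (_ | _) (_ | _) (_ | _) (_ | _) f g g' η h <;>
      first
      | rfl
      | exact conj_id (D := D) η
      | exact conj_id (D := D) (𝟙 _)
      | exact PEmpty.elim f
      | exact PEmpty.elim g
  whisker_exchange := by
    rintro (_ | _) (_ | _) (_ | _) f g h i η θ <;>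
      first
      | rfl
      | exact (Category.comp_id (obj := D) _).trans (Category.id_comp (obj := D) _).symm
      | exact (Category.id_comp (obj := D) _).trans (Category.comp_id (obj := D) _).symm
  pentagon := by
    rintro (_ | _) (_ | _) (_ | _) (_ | _) (_ | _) f g h i <;>
      first
      | rfl
      | exact conj_id (D := D) (𝟙 _)
      | exact congrArg (𝟙 _ ≫ ·) (Category.id_comp (obj := D) _)
      | exact PEmpty.elim f
      | exact PEmpty.elim g
      | exact PEmpty.elim h
  triangle := by
    rintro (_ | _) (_ | _) (_ | _) f g <;>
      first
      | rfl
      | exact Category.id_comp (obj := D) _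

instance : Bicategory.Strict (Suspension D) where
  id_comp := id_comp'
  comp_id := comp_id'
  assoc := assoc'
  leftUnitor_eqToIso _ := rfl
  rightUnitor_eqToIso _ := rfl
  associator_eqToIso _ _ _ := rfl

end Suspension

/-! ### Matrices as simplices of the nerve of a suspension -/

/-- The join of two preorders: every `left i` lies below every `right j`. -/
inductive OrdJoin (I J : Type*)
  | left : I → OrdJoin I J
  | right : J → OrdJoin I J

namespace OrdJoin

variable {I J : Type*} [Preorder I] [Preorder J]

/-- The order of the join. -/
def le : OrdJoin I J → OrdJoin I J → Prop
  | left i, left i' => i ≤ i'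
  | left _, right _ => True
  | right _, left _ => False
  | right j, right j' => j ≤ j'

instance : Preorder (OrdJoin I J) where
  le := le
  le_refl := by
    rintro (i | i)
    · exact le_refl i
    · exact le_refl i
  le_trans := by
    rintro (i | i) (j | j) (k | k) h h'
    · exact le_trans (show i ≤ j from h) h'
    · trivial
    · exact h'.elim
    · trivial
    · exact h.elim
    · exact h.elim
    · exact h'.elim
    · exact le_trans (show i ≤ j from h) h'

/-- The isomorphism `[n] ≅ [p - 1] * [q - 1]` for `p + q = n + 1`: the first `p` elements of `[n]`
go to the left part and the last `q` elements go to the right part. -/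
def ofFin (p q n : ℕ) (h : p + q = n + 1) : Fin (n + 1) →o OrdJoin (Fin p) (Fin q) where
  toFun i := if hi : i.val < p then left ⟨i.val, hi⟩ else right ⟨i.val - p, by omega⟩
  monotone' := by
    intro i j hij
    have hij' : i.val ≤ j.val := hij
    dsimp only
    split_ifs with h1 h2 h2
    · exact hij'
    · trivial
    · omega
    · exact Nat.sub_le_sub_right hij' p

end OrdJoin

namespace Suspension

variable {D : Type u} [Category.{v} D]

section

variable {I J : Type*} [Preorder I] [Preorder J]

/-- The objects: `x` on the left part, `y` on the right part. -/
def matObj : OrdJoin I J → Suspension D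
  | .left _ => x
  | .right _ => y

/-- The 1-morphisms: the entry `M (i, j)` from `left i` to `right j`, and identities elsewhere. -/
def matMap (M : I × Jᵒᵖ ⥤ D) : ∀ a b : OrdJoin I J, a ≤ b → ((matObj a : Suspension D) ⟶ matObj b)
  | .left _, .left _, _ => 𝟙 x
  | .left i, .right j, _ => M.obj (i, .op j)
  | .right _, .right _, _ => 𝟙 y
  | .right _, .left _, h => h.elim

/-- The 2-cells: `M (i, j) ⟶ M (i', j)` for `i ≤ i'` and `M (i, j') ⟶ M (i, j)` for `j ≤ j'`, as
given by the functor `M`, and identities elsewhere. -/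
def matCell (M : I × Jᵒᵖ ⥤ D) : ∀ (a b c : OrdJoin I J) (hab : a ≤ b) (hbc : b ≤ c),
    matMap M a c (hab.trans hbc) ⟶ matMap M a b hab ≫ matMap M b c hbc
  | .left _, .left _, .left _, _, _ => PUnit.unit
  | .left i, .left i', .right j, h, _ =>
    M.map (X := (i, .op j)) (Y := (i', .op j)) (homOfLE (show i ≤ i' from h), 𝟙 _)
  | .left i, .right j, .right j', _, h =>
    M.map (X := (i, .op j')) (Y := (i, .op j)) (𝟙 _, (homOfLE (show j ≤ j' from h)).op)
  | .right _, .right _, .right _, _, _ => PUnit.unit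
  | .right _, .left _, _, h, _ => h.elim
  | _, .right _, .left _, _, h => h.elim

lemma map_thin₁ (M : I × Jᵒᵖ ⥤ D) {A B C : I × Jᵒᵖ} (f : A ⟶ B) (g : B ⟶ C) (h : A ⟶ C) :
    M.map h ≫ 𝟙 (M.obj C) ≫ 𝟙 (M.obj C) = M.map f ≫ M.map g := by
  rw [← M.map_comp, Category.comp_id, Category.comp_id]
  exact congrArg M.map
    (Prod.ext (Subsingleton.elim _ _) (Quiver.Hom.unop_inj (Subsingleton.elim _ _)))

lemma map_thin₂ (M : I × Jᵒᵖ ⥤ D) {A B B' C : I × Jᵒᵖ} (f : A ⟶ B) (g : B ⟶ C) (f' : A ⟶ B')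
    (g' : B' ⟶ C) : M.map f ≫ M.map g ≫ 𝟙 (M.obj C) = M.map f' ≫ M.map g' := by
  rw [← map_thin₁ M f' g' (f ≫ g), M.map_comp]
  simp only [Category.comp_id]

lemma map_thin₃ (M : I × Jᵒᵖ ⥤ D) {A B C : I × Jᵒᵖ} (f : A ⟶ B) (g : B ⟶ C) (h : A ⟶ C) :
    M.map f ≫ M.map g ≫ 𝟙 (M.obj C) = M.map h ≫ 𝟙 (M.obj C) :=
  map_thin₂ M f g h (𝟙 _) |>.trans (by rw [M.map_id])

/-- The diagram of shape the join of `I` and `J` given by a `D`-valued matrix. -/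
def matDiagram (M : I × Jᵒᵖ ⥤ D) : Duskin.Diagram (OrdJoin I J) (Suspension D) where
  obj := matObj
  map := matMap M
  cell := matCell M
  map_self := by rintro (i | i) <;> rfl
  cell_left := by
    rintro (i | i) (k | k) h
    · rfl
    · exact M.map_id (i, .op k)
    · exact h.elim
    · rfl
  cell_right := by
    rintro (i | i) (k | k) h
    · rfl
    · exact M.map_id (i, .op k)
    · exact h.elim
    · rfl
  tetrahedron := by
    rintro (i | i) (j | j) (k | k) (l | l) hij hjk hkl
    all_goals first | rfl | exact hij.elim | exact hjk.elim | exact hkl.elim | skip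
    · exact map_thin₁ M _ _ _
    · exact map_thin₂ M _ _ _ _
    · exact map_thin₃ M _ _ _

end

/-- The simplex of the Duskin nerve of the suspension of `D` given by a `D`-valued matrix
`M : [k] × [l]ᵒᵖ ⥤ D` with `p = k + 1` rows and `q = l + 1` columns, in dimension `n = k + l + 1`:
the vertices `0, …, k` are `x`, the vertices `k + 1, …, n` are `y`, the edge from `i ≤ k` to
`k + 1 + j` is `M (i, j)`, and the 2-cells are given by the action of `M` on morphisms. -/
def ofMatrix {p q : ℕ} (n : ℕ) (h : p + q = n + 1) (M : Fin p × (Fin q)ᵒᵖ ⥤ D) :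
    (Duskin.nerve (Suspension D)).obj (.op (.mk n)) :=
  (matDiagram M).pullback (OrdJoin.ofFin p q n h)

end Suspension

/-! ### The free 2-cell and its staircase matrices -/

/-- The free 2-cell: the suspension of the ordinal `[1] = {0 < 1}`. -/
abbrev FreeTwoCell : Type := Suspension (Fin 2)

namespace FreeTwoCell

/-- The Duskin nerve of the free 2-cell. -/
abbrev N : SSet.{0} := Duskin.nerve FreeTwoCell

/-- The 1-morphism `f₀ : x ⟶ y`. -/
def f₀ : (Suspension.x : FreeTwoCell) ⟶ Suspension.y := show Fin 2 from 0

/-- The 1-morphism `f₁ : x ⟶ y`. -/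
def f₁ : (Suspension.x : FreeTwoCell) ⟶ Suspension.y := show Fin 2 from 1

/-- The `p × q` matrix with entry `0` at `(i, j)` if `i < j`, and `1` otherwise. -/
def staircase (p q : ℕ) : Fin p × (Fin q)ᵒᵖ ⥤ Fin 2 where
  obj a := if a.1.val < a.2.unop.val then 0 else 1
  map {a b} f := homOfLE (by
    have h1 : a.1.val ≤ b.1.val := leOfHom f.1
    have h2 : b.2.unop.val ≤ a.2.unop.val := leOfHom f.2.unop
    split_ifs <;> omega)

/-- The `p × q` matrix with entry `0` at `(i, j)` if `i ≤ j`, and `1` otherwise. -/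
def staircase' (p q : ℕ) : Fin p × (Fin q)ᵒᵖ ⥤ Fin 2 where
  obj a := if a.1.val ≤ a.2.unop.val then 0 else 1
  map {a b} f := homOfLE (by
    have h1 : a.1.val ≤ b.1.val := leOfHom f.1
    have h2 : b.2.unop.val ≤ a.2.unop.val := leOfHom f.2.unop
    split_ifs <;> omega)

end FreeTwoCell

/-! All hom-categories of the free 2-cell are preorders, so a simplex is determined by its vertices
and the labels of its edges (`eq_of_map_eq`). There is no 1-morphism from `y` to `x`, so the
vertices equal to `x` come first. Labels add under composition, so the 2-cells say exactly that
labels satisfy a triangle inequality (`entry_triangle`). A simplex is therefore a 0-1-matrix, with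
rows its `x`-vertices and columns its `y`-vertices, whose entries increase down the columns and
decrease along the rows.

Such a matrix is degenerate iff two consecutive rows or columns agree (`mem_nonDegenerate_iff`).
Write `r i` for the number of ones in row `i`. Distinct rows make `r` strictly increasing; distinct
columns make it hit every value strictly between 0 and the number of columns. Hence `r i = i + r 0`
with `r 0` equal to 0 or 1, which gives two staircases (`staircase_of_no_repeats`); the dimension
then fixes their sizes.

Deleting a row of a staircase makes at most one pair of adjacent columns equal, and dually. This
yields a degeneracy of a smaller staircase, except at the boundary, where a constant row or column
is removed and a staircase is left. Conversely, above dimension one the faces determine a simplex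
(`eq_of_δ_eq`). -/

namespace FreeTwoCell

open Suspension

/-! ### Simplices as vertices together with numerical labels -/

/-- The label of a 1-morphism: `k` for `f_k`, and `0` for the identities. -/
def label : ∀ {a b : FreeTwoCell}, (a ⟶ b) → ℕ
  | x, x, _ => 0
  | x, y, d => (show Fin 2 from d).val
  | y, x, _ => 0
  | y, y, _ => 0

lemma label_lt_two : ∀ {a b : FreeTwoCell} (f : a ⟶ b), label f < 2
  | x, x, _ => Nat.zero_lt_two
  | x, y, d => (show Fin 2 from d).isLt
  | y, x, _ => Nat.zero_lt_two
  | y, y, _ => Nat.zero_lt_two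

lemma label_injective : ∀ {a b : FreeTwoCell} {f g : a ⟶ b}, label f = label g → f = g
  | x, x, _, _, _ => rfl
  | x, y, _, _, h => Fin.ext h
  | y, x, f, _, _ => nomatch (show PEmpty from f)
  | y, y, _, _, _ => rfl

lemma label_self : ∀ {a : FreeTwoCell} (f : a ⟶ a), label f = 0
  | x, _ => rfl
  | y, _ => rfl

/-- One of two composable 1-morphisms is always an identity, whose label is 0. -/
lemma label_comp : ∀ {a b c : FreeTwoCell} (f : a ⟶ b) (g : b ⟶ c),
    label (f ≫ g) = label f + label g
  | x, x, x, _, _ => rfl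
  | x, x, y, _, _ => (Nat.zero_add _).symm
  | x, y, y, _, _ => rfl
  | y, y, y, _, _ => rfl
  | x, y, x, _, e => nomatch (show PEmpty from e)
  | y, x, _, e, _ => nomatch (show PEmpty from e)
  | y, y, x, _, e => nomatch (show PEmpty from e)

lemma label_mono : ∀ {a b : FreeTwoCell} {f g : a ⟶ b}, (f ⟶ g) → label f ≤ label g
  | x, x, _, _, _ => le_rfl
  | x, y, f, g, η => leOfHom (show (show Fin 2 from f) ⟶ (show Fin 2 from g) from η)
  | y, x, _, _, _ => le_rfl
  | y, y, _, _, _ => le_rfl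

lemma hom₂_subsingleton : ∀ {a b : FreeTwoCell} (f g : a ⟶ b), Subsingleton (f ⟶ g)
  | x, x, _, _ => inferInstanceAs (Subsingleton PUnit)
  | x, y, f, g => inferInstanceAs (Subsingleton ((show Fin 2 from f) ⟶ (show Fin 2 from g)))
  | y, x, _, _ => inferInstanceAs (Subsingleton PUnit)
  | y, y, _, _ => inferInstanceAs (Subsingleton PUnit)

lemma isEmpty_hom_y_x : IsEmpty ((y : FreeTwoCell) ⟶ x) := inferInstanceAs (IsEmpty PEmpty)

/-- Parallel 2-cells are equal, so the cells carry no data. Comparing labels instead of 1-morphisms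
avoids transport between hom types over merely equal objects. -/
lemma eq_of_map_eq {I : Type*} [Preorder I] {s t : Duskin.Diagram I FreeTwoCell}
    (hobj : ∀ i, s.obj i = t.obj i) (hmap : ∀ i j h, label (s.map i j h) = label (t.map i j h)) :
    s = t := by
  obtain ⟨o, m, c, _, _, _, _⟩ := s
  obtain ⟨o', m', c', _, _, _, _⟩ := t
  obtain rfl : o = o' := funext hobj
  obtain rfl : m = m' := by
    funext i j h
    exact label_injective (hmap i j h)
  obtain rfl : c = c' := by
    funext i j k hij hjk
    exact (hom₂_subsingleton _ _).elim _ _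
  rfl

variable {n : ℕ}

/-- The vertex `i` of a simplex is `x`. -/
def IsX (t : N.obj (.op (.mk n))) (i : ℕ) : Prop :=
  ∃ h : i < n + 1, Duskin.Diagram.obj (I := Fin (n + 1)) t ⟨i, h⟩ = x

/-- The label of the edge of a simplex from the vertex `i` to the vertex `j`, extended by `0`. -/
def entry (t : N.obj (.op (.mk n))) (i j : ℕ) : ℕ :=
  if h : i ≤ j ∧ j < n + 1 then
    label (Duskin.Diagram.map (I := Fin (n + 1)) t ⟨i, h.1.trans_lt h.2⟩ ⟨j, h.2⟩ h.1)
  else 0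

lemma simplex_ext {s t : N.obj (.op (.mk n))} (h : ∀ i ≤ n, IsX s i ↔ IsX t i)
    (h' : ∀ i j, i < j → j ≤ n → entry s i j = entry t i j) : s = t := by
  refine eq_of_map_eq (I := Fin (n + 1)) (fun i => ?_) (fun i j hij => ?_)
  · have hi := h i (Nat.le_of_lt_succ i.isLt)
    have aux : ∀ {a b : FreeTwoCell}, (a = x ↔ b = x) → a = b := by
      rintro (_ | _) (_ | _) <;> simp
    exact aux ⟨fun e => (hi.1 ⟨i.isLt, e⟩).2, fun e => (hi.2 ⟨i.isLt, e⟩).2⟩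
  · rcases hij.lt_or_eq with hlt | rfl
    · have := h' i j hlt (Nat.le_of_lt_succ j.isLt)
      have hc : i.val ≤ j.val ∧ j.val < n + 1 := ⟨hij, j.isLt⟩
      rw [entry, entry, dif_pos hc, dif_pos hc] at this
      exact this
    · rw [label_self, label_self]

lemma entry_lt_two (t : N.obj (.op (.mk n))) (i j : ℕ) : entry t i j < 2 := by
  unfold entry
  split_ifs
  · exact label_lt_two _
  · decide

lemma entry_of_isX_iff {t : N.obj (.op (.mk n))} {i j : ℕ} (h : IsX t i ↔ IsX t j) :
    entry t i j = 0 := by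
  unfold entry
  split_ifs with hij
  · have aux : ∀ {a b : FreeTwoCell} (f : a ⟶ b), (a = x ↔ b = x) → label f = 0 := by
      rintro (_ | _) (_ | _) f h
      · rfl
      · simp at h
      · rfl
      · rfl
    refine aux _ ⟨fun e => (h.1 ⟨_, e⟩).2, fun e => (h.2 ⟨_, e⟩).2⟩
  · rfl

lemma entry_of_lt {t : N.obj (.op (.mk n))} {i j : ℕ} (h : j < i) : entry t i j = 0 :=
  dif_neg fun hh => absurd hh.1 (not_le.2 h)

lemma IsX.of_le {t : N.obj (.op (.mk n))} {i j : ℕ} (h : IsX t j) (hij : i ≤ j) : IsX t i := by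
  obtain ⟨hj, e⟩ := h
  refine ⟨hij.trans_lt hj, ?_⟩
  have aux : ∀ {a b : FreeTwoCell} (_ : a ⟶ b), b = x → a = x := by
    rintro (_ | _) _ f rfl
    · rfl
    · exact isEmpty_hom_y_x.elim f
  exact aux (Duskin.Diagram.map (I := Fin (n + 1)) t ⟨i, _⟩ ⟨j, hj⟩ hij) e

/-- This is all the information in a 2-cell. When `i`, `j` or `j`, `k` lie in the same block, one
summand vanishes, which gives the monotonicity of the matrix. -/
lemma entry_triangle (t : N.obj (.op (.mk n))) {i j k : ℕ} (hij : i ≤ j) (hjk : j ≤ k)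
    (hk : k ≤ n) : entry t i k ≤ entry t i j + entry t j k := by
  have h1 : i ≤ k ∧ k < n + 1 := by omega
  have h2 : i ≤ j ∧ j < n + 1 := by omega
  have h3 : j ≤ k ∧ k < n + 1 := by omega
  rw [entry, entry, entry, dif_pos h1, dif_pos h2, dif_pos h3, ← label_comp]
  exact label_mono (Duskin.Diagram.cell (I := Fin (n + 1)) t ⟨i, _⟩ ⟨j, _⟩ ⟨k, _⟩ hij hjk)

/-! ### Faces and degeneracies in coordinates -/

lemma val_δ (i : Fin (n + 2)) (a : Fin (n + 1)) :
    ((SimplexCategory.δ i).toOrderHom a).val = if a.val < i.val then a.val else a.val + 1 := by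
  change (i.succAbove a).val = _
  rw [Fin.succAbove]
  split_ifs with h h' h' <;> simp_all [Fin.lt_def]

lemma val_σ (i : Fin (n + 1)) (a : Fin (n + 2)) :
    ((SimplexCategory.σ i).toOrderHom a).val = if a.val ≤ i.val then a.val else a.val - 1 := by
  change (i.predAbove a).val = _
  by_cases h : a.val ≤ i.val
  · rw [if_pos h, Fin.predAbove_of_le_castSucc i a h, Fin.coe_castPred]
  · rw [if_neg h, Fin.predAbove_of_castSucc_lt i a (not_le.1 h), Fin.val_pred]

lemma obj_congr {t : N.obj (.op (.mk n))} {a b : Fin (n + 1)} (h : a.val = b.val) :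
    Duskin.Diagram.obj (I := Fin (n + 1)) t a = Duskin.Diagram.obj (I := Fin (n + 1)) t b := by
  rw [Fin.ext h]

lemma label_map_congr {t : N.obj (.op (.mk n))} {a b a' b' : Fin (n + 1)} (hab : a ≤ b)
    (ha : a.val = a'.val) (hb : b.val = b'.val) (hab' : a' ≤ b') :
    label (Duskin.Diagram.map (I := Fin (n + 1)) t a b hab) =
      label (Duskin.Diagram.map (I := Fin (n + 1)) t a' b' hab') := by
  obtain rfl := Fin.ext ha
  obtain rfl := Fin.ext hb
  rfl

lemma isX_δ (t : N.obj (.op (.mk (n + 1)))) (i : Fin (n + 2)) (a : ℕ) :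
    IsX (N.δ i t) a ↔ IsX t (if a < i.val then a else a + 1) := by
  constructor
  · rintro ⟨h, e⟩
    refine ⟨by split_ifs <;> omega, ?_⟩
    rw [← e]
    exact obj_congr (val_δ i ⟨a, h⟩).symm
  · rintro ⟨h, e⟩
    have ha : a < n + 1 := by split_ifs at h <;> omega
    refine ⟨ha, ?_⟩
    rw [← e]
    exact obj_congr (t := t) (a := (SimplexCategory.δ i).toOrderHom ⟨a, ha⟩) (b := ⟨_, h⟩)
      (val_δ i ⟨a, ha⟩)

lemma isX_σ (t : N.obj (.op (.mk n))) (i : Fin (n + 1)) (a : ℕ) :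
    IsX (N.σ i t) a ↔ IsX t (if a ≤ i.val then a else a - 1) := by
  constructor
  · rintro ⟨h, e⟩
    refine ⟨by split_ifs <;> omega, ?_⟩
    rw [← e]
    exact obj_congr (val_σ i ⟨a, h⟩).symm
  · rintro ⟨h, e⟩
    have ha : a < n + 2 := by split_ifs at h <;> omega
    refine ⟨ha, ?_⟩
    rw [← e]
    exact obj_congr (t := t) (a := (SimplexCategory.σ i).toOrderHom ⟨a, ha⟩) (b := ⟨_, h⟩)
      (val_σ i ⟨a, ha⟩)

lemma entry_δ (t : N.obj (.op (.mk (n + 1)))) (i : Fin (n + 2)) (a b : ℕ) :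
    entry (N.δ i t) a b =
      entry t (if a < i.val then a else a + 1) (if b < i.val then b else b + 1) := by
  by_cases h : a ≤ b ∧ b < n + 1
  · have h' : (if a < i.val then a else a + 1) ≤ (if b < i.val then b else b + 1) ∧
        (if b < i.val then b else b + 1) < n + 1 + 1 := by
      split_ifs <;> omega
    have ha : a < n + 1 := by omega
    have hb : b < n + 1 := h.2
    rw [entry, entry, dif_pos h, dif_pos h']
    exact label_map_congr (t := t) (a := (SimplexCategory.δ i).toOrderHom ⟨a, ha⟩)
      (b := (SimplexCategory.δ i).toOrderHom ⟨b, hb⟩) (a' := ⟨_, h'.1.trans_lt h'.2⟩)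
      (b' := ⟨_, h'.2⟩) _ (val_δ i ⟨a, ha⟩) (val_δ i ⟨b, hb⟩) h'.1
  · have h' : ¬ ((if a < i.val then a else a + 1) ≤ (if b < i.val then b else b + 1) ∧
        (if b < i.val then b else b + 1) < n + 1 + 1) := by
      split_ifs <;> omega
    rw [entry, entry, dif_neg h, dif_neg h']

/-- Unlike a face map, a degeneracy map does not reflect the order: the pair `(i + 1, i)` goes to
`(i, i)`, which switches the branch of `entry`. Hence the restriction to `a ≤ b`. -/
lemma entry_σ_of_le (t : N.obj (.op (.mk n))) (i : Fin (n + 1)) {a b : ℕ} (hab : a ≤ b) :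
    entry (N.σ i t) a b =
      entry t (if a ≤ i.val then a else a - 1) (if b ≤ i.val then b else b - 1) := by
  by_cases h : b < n + 2
  · have h' : (if a ≤ i.val then a else a - 1) ≤ (if b ≤ i.val then b else b - 1) ∧
        (if b ≤ i.val then b else b - 1) < n + 1 := by
      split_ifs <;> omega
    have ha : a < n + 2 := by omega
    have hb : b < n + 2 := h
    rw [entry, entry, dif_pos ⟨hab, h⟩, dif_pos h']
    exact label_map_congr (t := t) (a := (SimplexCategory.σ i).toOrderHom ⟨a, ha⟩)
      (b := (SimplexCategory.σ i).toOrderHom ⟨b, hb⟩) (a' := ⟨_, h'.1.trans_lt h'.2⟩)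
      (b' := ⟨_, h'.2⟩) _ (val_σ i ⟨a, ha⟩) (val_σ i ⟨b, hb⟩) h'.1
  · have h' : ¬ ((if a ≤ i.val then a else a - 1) ≤ (if b ≤ i.val then b else b - 1) ∧
        (if b ≤ i.val then b else b - 1) < n + 1) := by
      split_ifs <;> omega
    rw [entry, entry, dif_neg fun hh => h hh.2, dif_neg h']

/-! ### Coordinates of a simplex given by a matrix -/

lemma ofFin_of_lt {p q : ℕ} (h : p + q = n + 1) {i : Fin (n + 1)} (hi : i.val < p) :
    OrdJoin.ofFin p q n h i = .left ⟨i.val, hi⟩ :=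
  dif_pos hi

lemma ofFin_of_ge {p q : ℕ} (h : p + q = n + 1) {i : Fin (n + 1)} (hi : p ≤ i.val) :
    OrdJoin.ofFin p q n h i = .right ⟨i.val - p, by omega⟩ :=
  dif_neg (not_lt.2 hi)

lemma isX_ofMatrix {p q : ℕ} (h : p + q = n + 1) (M : Fin p × (Fin q)ᵒᵖ ⥤ Fin 2) (i : ℕ) :
    IsX (ofMatrix n h M) i ↔ i < p := by
  have key : ∀ hi : i < n + 1, Duskin.Diagram.obj (I := Fin (n + 1)) (ofMatrix n h M) ⟨i, hi⟩ =
      matObj (OrdJoin.ofFin p q n h ⟨i, hi⟩) := fun _ => rfl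
  by_cases hp : i < p
  · refine iff_of_true ⟨by omega, ?_⟩ hp
    rw [key, ofFin_of_lt h hp]
    rfl
  · refine iff_of_false (fun ⟨hi, e⟩ => ?_) hp
    rw [key, ofFin_of_ge h (not_lt.1 hp)] at e
    exact Suspension.noConfusion rfl (heq_of_eq e)

lemma entry_ofMatrix {p q : ℕ} (h : p + q = n + 1) (M : Fin p × (Fin q)ᵒᵖ ⥤ Fin 2) (i j : ℕ) :
    entry (ofMatrix n h M) i j =
      if h : i < p ∧ p ≤ j ∧ j - p < q then (M.obj (⟨i, h.1⟩, .op ⟨j - p, h.2.2⟩)).val else 0 := by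
  split_ifs with hij
  · have hc : i ≤ j ∧ j < n + 1 := by omega
    rw [entry, dif_pos hc]
    -- The endpoints are generalised so that their values can be substituted despite the dependent
    -- type of `matMap`.
    have aux : ∀ (a b : OrdJoin (Fin p) (Fin q)) (hab : a ≤ b) (i : Fin p) (j : Fin q),
        a = .left i → b = .right j → label (matMap M a b hab) = (M.obj (i, .op j)).val := by
      rintro a b hab i j rfl rfl
      rfl
    exact aux _ _ _ _ _ (ofFin_of_lt h hij.1) (ofFin_of_ge h hij.2.1)
  · by_cases hj : j ≤ n
    · by_cases hc : i ≤ j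
      · refine entry_of_isX_iff ?_
        rw [isX_ofMatrix, isX_ofMatrix]
        omega
      · exact entry_of_lt (by omega)
    · exact dif_neg (by omega)

/-! ### Determination by faces -/

/-- Every simplex of dimension at least two is determined by its faces. -/
lemma eq_of_δ_eq {s t : N.obj (.op (.mk (n + 2)))} (h : ∀ i, N.δ i s = N.δ i t) : s = t := by
  have hX : ∀ (i : Fin (n + 3)) (a : ℕ), IsX s (if a < i.val then a else a + 1) ↔
      IsX t (if a < i.val then a else a + 1) := fun i a => by
    rw [← isX_δ, ← isX_δ, h]
  have hE : ∀ (i : Fin (n + 3)) (a b : ℕ),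
      entry s (if a < i.val then a else a + 1) (if b < i.val then b else b + 1) =
      entry t (if a < i.val then a else a + 1) (if b < i.val then b else b + 1) := fun i a b => by
    rw [← entry_δ, ← entry_δ, h]
  -- Among at least three vertices, any edge avoids one of the vertices 0, 1, 2, so it is visible in
  -- one of the first three faces.
  refine simplex_ext (fun i _ => ?_) (fun i j hij _ => ?_)
  · rcases i with _ | i
    · simpa using hX ⟨1, by omega⟩ 0
    · simpa using hX 0 i
  · rcases i with _ | i
    · rcases Nat.lt_or_ge j 2 with hj | hj
      · simpa [hj, show 0 < j from hij] using hE ⟨2, by omega⟩ 0 j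
      · obtain ⟨j, rfl⟩ := Nat.exists_eq_add_of_le' hj
        simpa using hE ⟨1, by omega⟩ 0 (j + 1)
    · obtain ⟨j, rfl⟩ := Nat.exists_eq_add_of_le' (show 1 ≤ j by omega)
      simpa using hE 0 i j

/-! ### Degeneracy as a repeated row or column -/

/-- The vertices `k` and `k + 1` of a simplex cannot be told apart. -/
structure Repeats (t : N.obj (.op (.mk n))) (k : ℕ) : Prop where
  isX : IsX t k ↔ IsX t (k + 1)
  row : ∀ j, k + 1 < j → j ≤ n → entry t k j = entry t (k + 1) j
  col : ∀ j, j < k → entry t j k = entry t j (k + 1)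

lemma repeats_σ (t : N.obj (.op (.mk n))) (k : Fin (n + 1)) : Repeats (N.σ k t) k.val where
  isX := by simp [isX_σ]
  row j hj _ := by
    rw [entry_σ_of_le _ _ (by omega), entry_σ_of_le _ _ (by omega)]
    simp
  col j hj := by
    rw [entry_σ_of_le _ _ (by omega), entry_σ_of_le _ _ (by omega)]
    simp

lemma Repeats.σ_δ {t : N.obj (.op (.mk (n + 1)))} {k : Fin (n + 1)} (h : Repeats t k.val) :
    N.σ k (N.δ k.castSucc t) = t := by
  -- On vertices, the composite operator moves `k` to `k + 1` and fixes all others.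
  have key : ∀ a, (if (if a ≤ k.val then a else a - 1) < k.castSucc.val then
      (if a ≤ k.val then a else a - 1) else (if a ≤ k.val then a else a - 1) + 1) =
      if a = k.val then k.val + 1 else a := by
    intro a
    rw [Fin.val_castSucc]
    split_ifs <;> omega
  refine simplex_ext (fun i _ => ?_) (fun i j hij hj => ?_)
  · rw [isX_σ, isX_δ, key]
    split_ifs with hi
    · rw [hi, h.isX]
    · rfl
  · rw [entry_σ_of_le _ _ hij.le, entry_δ, key, key]
    split_ifs with hi hj' hj'
    · omega
    · rw [hi]
      rcases (show k.val + 1 ≤ j by omega).eq_or_lt with rfl | hlt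
      · rw [entry_of_isX_iff Iff.rfl, entry_of_isX_iff h.isX]
      · exact (h.row j hlt hj).symm
    · rw [hj']
      exact (h.col i (by omega)).symm
    · rfl

lemma mem_nonDegenerate_iff (t : N.obj (.op (.mk n))) :
    t ∈ N.nonDegenerate n ↔ ∀ k < n, ¬ Repeats t k := by
  rw [SSet.mem_nonDegenerate_iff_notMem_degenerate]
  rcases n with _ | n
  · simp
  · rw [SSet.degenerate_eq_iUnion_range_σ]
    simp only [Set.mem_iUnion, Set.mem_range, not_exists]
    constructor
    · exact fun h k hk hr => h ⟨k, hk⟩ _ (Repeats.σ_δ (k := ⟨k, hk⟩) hr)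
    · rintro h k u rfl
      exact h k.val k.isLt (repeats_σ u k)

/-! ### Monotone 0-1-matrices without repetitions -/

lemma exists_threshold (q : ℕ) (P : ℕ → Prop) (hP : ∀ i j, i ≤ j → j < q → P j → P i) :
    ∃ r ≤ q, ∀ j < q, P j ↔ j < r := by
  induction q with
  | zero => exact ⟨0, le_rfl, fun j hj => absurd hj (Nat.not_lt_zero j)⟩
  | succ q ih =>
    obtain ⟨r, hr, h⟩ := ih fun i j hij hj => hP i j hij (by omega)
    by_cases hq : P q
    · exact ⟨q + 1, le_rfl, fun j hj => iff_of_true (hP j q (by omega) (by omega) hq) hj⟩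
    · refine ⟨r, by omega, fun j hj => ?_⟩
      rcases (Nat.le_of_lt_succ hj).eq_or_lt with rfl | hlt
      · exact iff_of_false hq (by omega)
      · exact h j hlt

/-- A monotone 0-1-matrix without repeated rows or columns is a staircase. -/
lemma staircase_of_no_repeats {p q : ℕ} (hpq : 0 < p + q) {P : ℕ → ℕ → Prop}
    (hrow : ∀ i i' j, i ≤ i' → i' < p → j < q → P i j → P i' j)
    (hcol : ∀ i j j', j ≤ j' → i < p → j' < q → P i j' → P i j)
    (hrow' : ∀ i, i + 1 < p → ∃ j < q, P (i + 1) j ∧ ¬ P i j)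
    (hcol' : ∀ j, j + 1 < q → ∃ i < p, P i j ∧ ¬ P i (j + 1)) :
    ((q = p ∨ q = p + 1) ∧ ∀ i < p, ∀ j < q, P i j ↔ j ≤ i) ∨
      ((p = q ∨ p = q + 1) ∧ ∀ i < p, ∀ j < q, P i j ↔ j < i) := by
  -- Row `i` consists of `r` ones followed by zeros. Putting `i < p` under the existential makes `r`
  -- a function on all of `ℕ`.
  have hex : ∀ i, ∃ r, i < p → r ≤ q ∧ ∀ j < q, P i j ↔ j < r := fun i => by
    by_cases hi : i < p
    · obtain ⟨r, h⟩ := exists_threshold q (P i) fun j j' hj hj' => hcol i j j' hj hi hj'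
      exact ⟨r, fun _ => h⟩
    · exact ⟨0, fun h => absurd h hi⟩
  choose r hr using hex
  have hsucc_lt : ∀ i, i + 1 < p → r i < r (i + 1) := fun i hi => by
    obtain ⟨j, hj, h1, h2⟩ := hrow' i hi
    rw [(hr _ hi).2 j hj] at h1
    rw [(hr i (by omega)).2 j hj] at h2
    omega
  -- A row telling columns `j` and `j + 1` apart must have its last one in column `j`.
  have hhit : ∀ j, j + 1 < q → ∃ i < p, r i = j + 1 := fun j hj => by
    obtain ⟨i, hi, h1, h2⟩ := hcol' j hj
    rw [(hr i hi).2 j (by omega)] at h1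
    rw [(hr i hi).2 _ hj] at h2
    exact ⟨i, hi, by omega⟩
  have hmono : ∀ i i', i ≤ i' → i' < p → r i ≤ r i' := by
    intro i i' hi
    induction i', hi using Nat.le_induction with
    | base => exact fun _ => le_rfl
    | succ k _ ih => exact fun hk => (ih (by omega)).trans (hsucc_lt k hk).le
  -- A larger jump would skip the value `r i + 1`, which `hhit` forces some row to attain.
  have hstep : ∀ i, i + 1 < p → r (i + 1) = r i + 1 := fun i hi => by
    by_contra hne
    have h1 := hsucc_lt i hi
    have h2 := (hr _ hi).1
    obtain ⟨k, hk, h3⟩ := hhit (r i) (by omega)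
    rcases Nat.lt_or_ge i k with h | h
    · have := hmono (i + 1) k h hk
      omega
    · have := hmono k i h (by omega)
      omega
  have hlin : ∀ i < p, r i = i + r 0 := by
    intro i
    induction i with
    | zero => simp
    | succ i ih =>
      intro hi
      rw [hstep i hi, ih (by omega)]
      omega
  rcases Nat.eq_zero_or_pos p with rfl | hp
  · refine Or.inl ⟨Or.inr ?_, by simp⟩
    by_contra hq
    obtain ⟨i, hi, -⟩ := hhit 0 (by omega)
    omega
  · have h0 : r 0 ≤ 1 := by
      by_contra h
      have := (hr 0 hp).1
      obtain ⟨i, hi, h1⟩ := hhit 0 (by omega)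
      have := hlin i hi
      omega
    have hlast := hlin (p - 1) (by omega)
    have hle := (hr (p - 1) (by omega)).1
    -- Otherwise `hhit` gives a row with more ones than the last one.
    have hge : q ≤ r (p - 1) + 1 := by
      by_contra h
      obtain ⟨i, hi, h1⟩ := hhit (r (p - 1)) (by omega)
      have := hmono i (p - 1) (by omega) (by omega)
      omega
    rcases (show r 0 = 0 ∨ r 0 = 1 by omega) with h | h
    · refine Or.inr ⟨by omega, fun i hi j hj => ?_⟩
      rw [(hr i hi).2 j hj, hlin i hi, h, Nat.add_zero]
    · refine Or.inl ⟨by omega, fun i hi j hj => ?_⟩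
      rw [(hr i hi).2 j hj, hlin i hi, h, Nat.lt_succ_iff]

/-! ### The staircases are exactly the non-degenerate simplices -/

/-- The simplex given by the staircase matrix whose first step is a column. -/
def stair (n : ℕ) : N.obj (.op (.mk n)) :=
  ofMatrix n (by omega) (staircase ((n + 1) / 2) (n / 2 + 1))

/-- The simplex given by the staircase matrix whose first step is a row. -/
def stair' (n : ℕ) : N.obj (.op (.mk n)) :=
  ofMatrix n (by omega) (staircase' (n / 2 + 1) ((n + 1) / 2))

lemma isX_stair (n i : ℕ) : IsX (stair n) i ↔ i < (n + 1) / 2 := isX_ofMatrix _ _ _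

lemma isX_stair' (n i : ℕ) : IsX (stair' n) i ↔ i < n / 2 + 1 := isX_ofMatrix _ _ _

lemma entry_staircase {p q : ℕ} (h : p + q = n + 1) (i j : ℕ) :
    entry (ofMatrix n h (staircase p q)) i j =
      if i < p ∧ p ≤ j ∧ j ≤ n ∧ j ≤ i + p then 1 else 0 := by
  rw [entry_ofMatrix]
  by_cases hc : i < p ∧ p ≤ j ∧ j - p < q
  · rw [dif_pos hc]
    change (if i < j - p then (0 : Fin 2) else 1).val = _
    split_ifs <;> first | rfl | omega
  · rw [dif_neg hc, if_neg (by omega)]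

lemma entry_staircase' {p q : ℕ} (h : p + q = n + 1) (i j : ℕ) :
    entry (ofMatrix n h (staircase' p q)) i j =
      if i < p ∧ p ≤ j ∧ j ≤ n ∧ j < i + p then 1 else 0 := by
  rw [entry_ofMatrix]
  by_cases hc : i < p ∧ p ≤ j ∧ j - p < q
  · rw [dif_pos hc]
    change (if i ≤ j - p then (0 : Fin 2) else 1).val = _
    split_ifs <;> first | rfl | omega
  · rw [dif_neg hc, if_neg (by omega)]

lemma entry_stair (n i j : ℕ) : entry (stair n) i j =
    if i < (n + 1) / 2 ∧ (n + 1) / 2 ≤ j ∧ j ≤ n ∧ j ≤ i + (n + 1) / 2 then 1 else 0 :=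
  entry_staircase _ _ _

lemma entry_stair' (n i j : ℕ) : entry (stair' n) i j =
    if i < n / 2 + 1 ∧ n / 2 + 1 ≤ j ∧ j ≤ n ∧ j < i + (n / 2 + 1) then 1 else 0 :=
  entry_staircase' _ _ _

/-- For even `n` the numbers of `x`-vertices differ; for odd `n` the top left matrix entries differ.
-/
lemma stair_ne_stair' (n : ℕ) : stair n ≠ stair' n := by
  intro h
  have h1 := isX_stair n (n / 2)
  rw [h, isX_stair'] at h1
  have h2 := entry_stair n 0 ((n + 1) / 2)
  rw [h, entry_stair', if_neg (by omega), if_pos (by omega)] at h2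
  exact absurd h2 zero_ne_one

lemma stair_mem_nonDegenerate (n : ℕ) : stair n ∈ N.nonDegenerate n := by
  rw [mem_nonDegenerate_iff]
  intro k hk h
  have h1 := h.isX
  rw [isX_stair, isX_stair] at h1
  rcases Nat.lt_or_ge k ((n + 1) / 2) with hp | hp
  · have h2 := h.row (k + 1 + (n + 1) / 2) (by omega) (by omega)
    rw [entry_stair, entry_stair, if_neg (by omega), if_pos (by omega)] at h2
    exact absurd h2 zero_ne_one
  · have h2 := h.col (k - (n + 1) / 2) (by omega)
    rw [entry_stair, entry_stair, if_pos (by omega), if_neg (by omega)] at h2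
    exact absurd h2 one_ne_zero

lemma stair'_mem_nonDegenerate (n : ℕ) : stair' n ∈ N.nonDegenerate n := by
  rw [mem_nonDegenerate_iff]
  intro k hk h
  have h1 := h.isX
  rw [isX_stair', isX_stair'] at h1
  rcases Nat.lt_or_ge k (n / 2 + 1) with hp | hp
  · have h2 := h.row (k + (n / 2 + 1)) (by omega) (by omega)
    rw [entry_stair', entry_stair', if_neg (by omega), if_pos (by omega)] at h2
    exact absurd h2 zero_ne_one
  · have h2 := h.col (k + 1 - (n / 2 + 1)) (by omega)
    rw [entry_stair', entry_stair', if_pos (by omega), if_neg (by omega)] at h2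
    exact absurd h2 one_ne_zero

lemma eq_stair_of_mem_nonDegenerate {t : N.obj (.op (.mk n))} (ht : t ∈ N.nonDegenerate n) :
    t = stair n ∨ t = stair' n := by
  rw [mem_nonDegenerate_iff] at ht
  obtain ⟨p, hp, hX⟩ := exists_threshold (n + 1) (IsX t) fun i j hij _ h => h.of_le hij
  obtain ⟨q, hq⟩ : ∃ q, p + q = n + 1 := ⟨n + 1 - p, by omega⟩
  have hzero : ∀ i j, i ≤ n → j ≤ n → (i < p ↔ j < p) → entry t i j = 0 := fun i j hi hj h =>
    entry_of_isX_iff (by rw [hX i (by omega), hX j (by omega), h])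
  have hlt := entry_lt_two t
  have hst := staircase_of_no_repeats (p := p) (q := q) (P := fun i j => entry t i (p + j) = 1)
    (by omega)
    (fun i i' j hi hi' hj h => by
      have h1 := entry_triangle t hi (show i' ≤ p + j by omega) (by omega)
      have h2 := hzero i i' (by omega) (by omega) (by omega)
      have h3 := hlt i' (p + j)
      omega)
    (fun i j j' hj hi hj' h => by
      have h1 := entry_triangle t (show i ≤ p + j by omega) (show p + j ≤ p + j' by omega)
        (by omega)
      have h2 := hzero (p + j) (p + j') (by omega) (by omega) (by omega)
      have h3 := hlt i (p + j)
      omega)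
    (fun i hi => by
      -- If no column had a one only in row `i + 1`, the triangle inequality would make rows `i` and
      -- `i + 1` equal, against non-degeneracy. The argument for columns is dual.
      by_contra! hcon
      refine ht i (by omega) ⟨?_, fun j hj hjn => ?_, fun j hj => ?_⟩
      · rw [hX i (by omega), hX (i + 1) (by omega)]
        omega
      · rcases Nat.lt_or_ge j p with hjp | hjp
        · rw [hzero i j (by omega) hjn (by omega), hzero (i + 1) j (by omega) hjn (by omega)]
        · obtain ⟨j, rfl⟩ := Nat.exists_eq_add_of_le hjp
          have h1 := entry_triangle t (show i ≤ i + 1 by omega) hj.le hjn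
          have h2 := hzero i (i + 1) (by omega) (by omega) (by omega)
          have h3 := hcon j (by omega)
          have h4 := hlt (i + 1) (p + j)
          omega
      · rw [hzero j i (by omega) (by omega) (by omega),
          hzero j (i + 1) (by omega) (by omega) (by omega)])
    (fun j hj => by
      by_contra! hcon
      refine ht (p + j) (by omega) ⟨?_, fun i hi hin => ?_, fun i hi => ?_⟩
      · rw [hX _ (by omega), hX _ (by omega)]
        omega
      · rw [hzero _ i (by omega) hin (by omega), hzero _ i (by omega) hin (by omega)]
      · rcases Nat.lt_or_ge i p with hip | hip
        · have h1 := entry_triangle t hi.le (show p + j ≤ p + j + 1 by omega) (by omega)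
          have h2 := hzero (p + j) (p + j + 1) (by omega) (by omega) (by omega)
          have h3 := hcon i hip
          have h4 := hlt i (p + j)
          rw [← Nat.add_assoc] at h3
          omega
        · rw [hzero i _ (by omega) (by omega) (by omega),
            hzero i _ (by omega) (by omega) (by omega)])
  rcases hst with ⟨h, hP⟩ | ⟨h, hP⟩
  · obtain rfl : p = (n + 1) / 2 := by omega
    refine Or.inl (simplex_ext (fun i hi => ?_) (fun i j hij hj => ?_))
    · rw [hX i (by omega), isX_stair]
    · rw [entry_stair]
      by_cases hc : i < (n + 1) / 2 ∧ (n + 1) / 2 ≤ j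
      · obtain ⟨j, rfl⟩ := Nat.exists_eq_add_of_le hc.2
        have h1 := hP i hc.1 j (by omega)
        have h2 := hlt i ((n + 1) / 2 + j)
        split_ifs <;> omega
      · rw [hzero i j (by omega) hj (by omega), if_neg (by omega)]
  · obtain rfl : p = n / 2 + 1 := by omega
    refine Or.inr (simplex_ext (fun i hi => ?_) (fun i j hij hj => ?_))
    · rw [hX i (by omega), isX_stair']
    · rw [entry_stair']
      by_cases hc : i < n / 2 + 1 ∧ n / 2 + 1 ≤ j
      · obtain ⟨j, rfl⟩ := Nat.exists_eq_add_of_le hc.2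
        have h1 := hP i hc.1 j (by omega)
        have h2 := hlt i (n / 2 + 1 + j)
        split_ifs <;> omega
      · rw [hzero i j (by omega) hj (by omega), if_neg (by omega)]

lemma nonDegenerate_eq (n : ℕ) : N.nonDegenerate n = {stair n, stair' n} := by
  refine Set.Subset.antisymm (fun t ht => eq_stair_of_mem_nonDegenerate ht) ?_
  rintro t (rfl | rfl)
  · exact stair_mem_nonDegenerate n
  · exact stair'_mem_nonDegenerate n

/-! ### Dimensions 0 and 1, and the matrix sizes for each parity -/

lemma isX_vertex (a : FreeTwoCell) : IsX (Duskin.vertex a) 0 ↔ a = x :=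
  ⟨fun ⟨_, h⟩ => h, fun h => ⟨Nat.zero_lt_one, h⟩⟩

lemma stair_zero : stair 0 = Duskin.vertex y := by
  refine simplex_ext (fun i hi => ?_) (fun i j hij hj => by omega)
  obtain rfl : i = 0 := by omega
  rw [isX_stair, isX_vertex]
  exact iff_of_false (by omega) (fun h => Suspension.noConfusion rfl (heq_of_eq h))

lemma stair'_zero : stair' 0 = Duskin.vertex x := by
  refine simplex_ext (fun i hi => ?_) (fun i j hij hj => by omega)
  obtain rfl : i = 0 := by omega
  rw [isX_stair', isX_vertex]
  exact iff_of_true (by omega) rfl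

lemma isX_edge (f : (x : FreeTwoCell) ⟶ y) {i : ℕ} (hi : i ≤ 1) :
    IsX (Duskin.edge f) i ↔ i = 0 := by
  rcases (show i = 0 ∨ i = 1 by omega) with rfl | rfl
  · exact iff_of_true ⟨Nat.zero_lt_two, rfl⟩ rfl
  · exact iff_of_false (fun ⟨_, h⟩ => Suspension.noConfusion rfl (heq_of_eq h)) one_ne_zero

lemma entry_edge (f : (x : FreeTwoCell) ⟶ y) : entry (Duskin.edge f) 0 1 = label f := by
  rw [entry, dif_pos ⟨Nat.zero_le 1, Nat.one_lt_two⟩]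
  rfl

lemma stair_one : stair 1 = Duskin.edge f₁ := by
  refine simplex_ext (fun i hi => ?_) (fun i j hij hj => ?_)
  · rw [isX_stair, isX_edge _ hi]
    omega
  · obtain rfl : i = 0 := by omega
    obtain rfl : j = 1 := by omega
    rw [entry_edge, entry_stair]
    rfl

lemma stair'_one : stair' 1 = Duskin.edge f₀ := by
  refine simplex_ext (fun i hi => ?_) (fun i j hij hj => ?_)
  · rw [isX_stair', isX_edge _ hi]
    omega
  · obtain rfl : i = 0 := by omega
    obtain rfl : j = 1 := by omega
    rw [entry_edge, entry_stair']
    rfl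

lemma stair_eq_ofMatrix {n p q : ℕ} (h : p + q = n + 1) (hp : p = (n + 1) / 2) :
    stair n = ofMatrix n h (staircase p q) := by
  obtain rfl : q = n / 2 + 1 := by omega
  subst hp
  rfl

lemma stair'_eq_ofMatrix {n p q : ℕ} (h : p + q = n + 1) (hp : p = n / 2 + 1) :
    stair' n = ofMatrix n h (staircase' p q) := by
  obtain rfl : q = (n + 1) / 2 := by omega
  subst hp
  rfl

/-! ### Faces of the staircases -/

section Faces

variable {n i k : ℕ}

/-- Only row `i` tells columns `i` and `i + 1` apart. After its deletion, column `i` is the vertex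
`(n + 1) / 2 + i`; the bound on `k` says that column `i + 1` exists. -/
lemma δ_stair_of_row (hk : k = (n + 1) / 2 + i)
    (hin : i < n + 3) (hkn : k < n + 1) :
    N.δ ⟨i, hin⟩ (stair (n + 2)) = N.σ ⟨k, hkn⟩ (stair n) := by
  refine simplex_ext (fun a _ => ?_) (fun a b hab _ => ?_)
  · rw [isX_δ, isX_σ, isX_stair, isX_stair]
    dsimp only
    split_ifs <;> omega
  · rw [entry_δ, entry_σ_of_le _ _ hab.le, entry_stair, entry_stair]
    dsimp only
    congr 1
    split_ifs <;> simp only [eq_iff_iff] <;> omega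

/-- Only column `c = i - (n + 3) / 2` tells rows `c - 1` and `c` apart. The bounds on `i` say that
both rows exist. -/
lemma δ_stair_of_col (hi : (n + 3) / 2 < i) (hi' : i ≤ 2 * ((n + 1) / 2) + 1)
    (hk : k = i - (n + 5) / 2) (hin : i < n + 3) (hkn : k < n + 1) :
    N.δ ⟨i, hin⟩ (stair (n + 2)) = N.σ ⟨k, hkn⟩ (stair n) := by
  refine simplex_ext (fun a _ => ?_) (fun a b hab _ => ?_)
  · rw [isX_δ, isX_σ, isX_stair, isX_stair]
    dsimp only
    split_ifs <;> omega
  · rw [entry_δ, entry_σ_of_le _ _ hab.le, entry_stair, entry_stair]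
    dsimp only
    congr 1
    split_ifs <;> simp only [eq_iff_iff] <;> omega

/-- Here row `i` separates columns `i - 1` and `i`, one step earlier than in `stair`. -/
lemma δ_stair'_of_row (hi : 1 ≤ i) (hk : k = n / 2 + i)
    (hin : i < n + 3) (hkn : k < n + 1) :
    N.δ ⟨i, hin⟩ (stair' (n + 2)) = N.σ ⟨k, hkn⟩ (stair' n) := by
  refine simplex_ext (fun a _ => ?_) (fun a b hab _ => ?_)
  · rw [isX_δ, isX_σ, isX_stair', isX_stair']
    dsimp only
    split_ifs <;> omega
  · rw [entry_δ, entry_σ_of_le _ _ hab.le, entry_stair', entry_stair']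
    dsimp only
    congr 1
    split_ifs <;> simp only [eq_iff_iff] <;> omega

lemma δ_stair'_of_col (hi : n / 2 + 2 ≤ i) (hi' : i ≤ 2 * (n / 2) + 2)
    (hk : k = i - (n / 2 + 2)) (hin : i < n + 3) (hkn : k < n + 1) :
    N.δ ⟨i, hin⟩ (stair' (n + 2)) = N.σ ⟨k, hkn⟩ (stair' n) := by
  refine simplex_ext (fun a _ => ?_) (fun a b hab _ => ?_)
  · rw [isX_δ, isX_σ, isX_stair', isX_stair']
    dsimp only
    split_ifs <;> omega
  · rw [entry_δ, entry_σ_of_le _ _ hab.le, entry_stair', entry_stair']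
    dsimp only
    congr 1
    split_ifs <;> simp only [eq_iff_iff] <;> omega

/-- The first column is constantly 1; dropping it shifts the column index and turns `j ≤ i` into `j
< i`. -/
lemma δ_stair_first (hi : i = (n + 2) / 2) (hin : i < n + 2) :
    N.δ ⟨i, hin⟩ (stair (n + 1)) = stair' n := by
  refine simplex_ext (fun a _ => ?_) (fun a b hab _ => ?_)
  · rw [isX_δ, isX_stair, isX_stair']
    dsimp only
    split_ifs <;> omega
  · rw [entry_δ, entry_stair, entry_stair']
    dsimp only
    congr 1
    split_ifs <;> simp only [eq_iff_iff] <;> omega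

/-- The matrix of `stair (n + 1)` is square here, so its last row is constantly 1 and separates no
columns. -/
lemma δ_stair_last_row (hi : i = n / 2) (hn : n % 2 = 0) (hin : i < n + 2) :
    N.δ ⟨i, hin⟩ (stair (n + 1)) = stair n := by
  refine simplex_ext (fun a _ => ?_) (fun a b hab _ => ?_)
  · rw [isX_δ, isX_stair, isX_stair]
    dsimp only
    split_ifs <;> omega
  · rw [entry_δ, entry_stair, entry_stair]
    dsimp only
    congr 1
    split_ifs <;> simp only [eq_iff_iff] <;> omega

lemma δ_stair_last_col (hi : i = n + 1) (hn : n % 2 = 1) (hin : i < n + 2) :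
    N.δ ⟨i, hin⟩ (stair (n + 1)) = stair n := by
  refine simplex_ext (fun a _ => ?_) (fun a b hab _ => ?_)
  · rw [isX_δ, isX_stair, isX_stair]
    dsimp only
    split_ifs <;> omega
  · rw [entry_δ, entry_stair, entry_stair]
    dsimp only
    congr 1
    split_ifs <;> simp only [eq_iff_iff] <;> omega

/-- The first row is constantly 0; dropping it turns `j < i` back into `j ≤ i`. -/
lemma δ_stair'_first (hi : i = 0) (hin : i < n + 2) :
    N.δ ⟨i, hin⟩ (stair' (n + 1)) = stair n := by
  refine simplex_ext (fun a _ => ?_) (fun a b hab _ => ?_)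
  · rw [isX_δ, isX_stair', isX_stair]
    dsimp only
    split_ifs <;> omega
  · rw [entry_δ, entry_stair', entry_stair]
    dsimp only
    congr 1
    split_ifs <;> simp only [eq_iff_iff] <;> omega

lemma δ_stair'_last_row (hi : i = (n + 1) / 2) (hn : n % 2 = 1) (hin : i < n + 2) :
    N.δ ⟨i, hin⟩ (stair' (n + 1)) = stair' n := by
  refine simplex_ext (fun a _ => ?_) (fun a b hab _ => ?_)
  · rw [isX_δ, isX_stair', isX_stair']
    dsimp only
    split_ifs <;> omega
  · rw [entry_δ, entry_stair', entry_stair']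
    dsimp only
    congr 1
    split_ifs <;> simp only [eq_iff_iff] <;> omega

lemma δ_stair'_last_col (hi : i = n + 1) (hn : n % 2 = 0) (hin : i < n + 2) :
    N.δ ⟨i, hin⟩ (stair' (n + 1)) = stair' n := by
  refine simplex_ext (fun a _ => ?_) (fun a b hab _ => ?_)
  · rw [isX_δ, isX_stair', isX_stair']
    dsimp only
    split_ifs <;> omega
  · rw [entry_δ, entry_stair', entry_stair']
    dsimp only
    congr 1
    split_ifs <;> simp only [eq_iff_iff] <;> omega

end Faces

end FreeTwoCell

open FreeTwoCell in
theorem proposition2 :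
    ∃ s s' : ∀ n : ℕ, FreeTwoCell.N.obj (.op (.mk n)),
      -- in each dimension `n`, the non-degenerate simplices are `s n` and `s' n`
      (∀ n : ℕ, s n ≠ s' n ∧ FreeTwoCell.N.nonDegenerate n = {s n, s' n}) ∧
      -- dimensions 0 and 1
      s 0 = Duskin.vertex Suspension.y ∧ s' 0 = Duskin.vertex Suspension.x ∧
      s 1 = Duskin.edge FreeTwoCell.f₁ ∧ s' 1 = Duskin.edge FreeTwoCell.f₀ ∧
      -- the staircase matrices
      (∀ m : ℕ, s (2 * m) = Suspension.ofMatrix (2 * m) (by omega)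
        (FreeTwoCell.staircase m (m + 1))) ∧
      (∀ m : ℕ, s' (2 * m) = Suspension.ofMatrix (2 * m) (by omega)
        (FreeTwoCell.staircase' (m + 1) m)) ∧
      (∀ m : ℕ, s (2 * m + 1) = Suspension.ofMatrix (2 * m + 1) (by omega)
        (FreeTwoCell.staircase (m + 1) (m + 1))) ∧
      (∀ m : ℕ, s' (2 * m + 1) = Suspension.ofMatrix (2 * m + 1) (by omega)
        (FreeTwoCell.staircase' (m + 1) (m + 1))) ∧
      -- the face relations in dimensions `2 * m + 2` and `2 * m + 3`, `m ≥ 0`;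
      -- the relations that determine `s (2 * m + 2)`
      (∀ (m : ℕ) (t : FreeTwoCell.N.obj (.op (.mk (2 * m + 2)))), t = s (2 * m + 2) ↔
        (∀ (i : ℕ) (_ : i ≤ m),
          FreeTwoCell.N.δ ⟨i, by omega⟩ t =
            FreeTwoCell.N.σ ⟨m + i, by omega⟩ (s (2 * m))) ∧
        FreeTwoCell.N.δ ⟨m + 1, by omega⟩ t = s' (2 * m + 1) ∧
        (∀ (i : ℕ) (_ : m + 2 ≤ i) (_ : i ≤ 2 * m + 1),
          FreeTwoCell.N.δ ⟨i, by omega⟩ t =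
            FreeTwoCell.N.σ ⟨i - m - 2, by omega⟩ (s (2 * m))) ∧
        FreeTwoCell.N.δ ⟨2 * m + 2, by omega⟩ t = s (2 * m + 1)) ∧
      -- the relations that determine `s' (2 * m + 2)`
      (∀ (m : ℕ) (t : FreeTwoCell.N.obj (.op (.mk (2 * m + 2)))), t = s' (2 * m + 2) ↔
        FreeTwoCell.N.δ ⟨0, by omega⟩ t = s (2 * m + 1) ∧
        (∀ (i : ℕ) (_ : 1 ≤ i) (_ : i ≤ m),
          FreeTwoCell.N.δ ⟨i, by omega⟩ t =
            FreeTwoCell.N.σ ⟨m + i, by omega⟩ (s' (2 * m))) ∧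
        FreeTwoCell.N.δ ⟨m + 1, by omega⟩ t = s' (2 * m + 1) ∧
        (∀ (i : ℕ) (_ : m + 2 ≤ i) (_ : i ≤ 2 * m + 2),
          FreeTwoCell.N.δ ⟨i, by omega⟩ t =
            FreeTwoCell.N.σ ⟨i - m - 2, by omega⟩ (s' (2 * m)))) ∧
      -- the relations that determine `s (2 * m + 3)`
      (∀ (m : ℕ) (t : FreeTwoCell.N.obj (.op (.mk (2 * m + 3)))), t = s (2 * m + 3) ↔
        (∀ (i : ℕ) (_ : i ≤ m),
          FreeTwoCell.N.δ ⟨i, by omega⟩ t =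
            FreeTwoCell.N.σ ⟨m + 1 + i, by omega⟩ (s (2 * m + 1))) ∧
        FreeTwoCell.N.δ ⟨m + 1, by omega⟩ t = s (2 * m + 2) ∧
        FreeTwoCell.N.δ ⟨m + 2, by omega⟩ t = s' (2 * m + 2) ∧
        (∀ (i : ℕ) (_ : m + 3 ≤ i) (_ : i ≤ 2 * m + 3),
          FreeTwoCell.N.δ ⟨i, by omega⟩ t =
            FreeTwoCell.N.σ ⟨i - m - 3, by omega⟩ (s (2 * m + 1)))) ∧
      -- the relations that determine `s' (2 * m + 3)`
      (∀ (m : ℕ) (t : FreeTwoCell.N.obj (.op (.mk (2 * m + 3)))), t = s' (2 * m + 3) ↔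
        FreeTwoCell.N.δ ⟨0, by omega⟩ t = s (2 * m + 2) ∧
        (∀ (i : ℕ) (_ : 1 ≤ i) (_ : i ≤ m + 1),
          FreeTwoCell.N.δ ⟨i, by omega⟩ t =
            FreeTwoCell.N.σ ⟨m + i, by omega⟩ (s' (2 * m + 1))) ∧
        (∀ (i : ℕ) (_ : m + 2 ≤ i) (_ : i ≤ 2 * m + 2),
          FreeTwoCell.N.δ ⟨i, by omega⟩ t =
            FreeTwoCell.N.σ ⟨i - m - 2, by omega⟩ (s' (2 * m + 1))) ∧
        FreeTwoCell.N.δ ⟨2 * m + 3, by omega⟩ t = s' (2 * m + 2)) := by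
  refine ⟨stair, stair', fun n => ⟨stair_ne_stair' n, nonDegenerate_eq n⟩, stair_zero, stair'_zero,
    stair_one, stair'_one, fun m => stair_eq_ofMatrix _ (by omega),
    fun m => stair'_eq_ofMatrix _ (by omega), fun m => stair_eq_ofMatrix _ (by omega),
    fun m => stair'_eq_ofMatrix _ (by omega), fun m t => ?_, fun m t => ?_, fun m t => ?_,
    fun m t => ?_⟩
  · constructor
    · rintro rfl
      exact ⟨fun i hi => δ_stair_of_row (by omega) _ _,
        δ_stair_first (by omega) _,
        fun i hi hi' => δ_stair_of_col (by omega) (by omega) (by omega) _ _,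
        δ_stair_last_col (by omega) (by omega) _⟩
    · rintro ⟨h1, h2, h3, h4⟩
      -- The relations prescribe every face, so the simplex is determined by them.
      refine eq_of_δ_eq fun ⟨i, hi⟩ => ?_
      rcases (show (i ≤ m) ∨
        (i = m + 1) ∨
        (m + 2 ≤ i ∧ i ≤ 2 * m + 1) ∨
        (i = 2 * m + 2) by omega) with
        h | rfl | ⟨h, h'⟩ | rfl
      · exact (h1 i h).trans (δ_stair_of_row (by omega) _ _).symm
      · exact h2.trans (δ_stair_first (by omega) _).symm
      · exact (h3 i h h').trans (δ_stair_of_col (by omega) (by omega) (by omega) _ _).symm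
      · exact h4.trans (δ_stair_last_col (by omega) (by omega) _).symm
  · constructor
    · rintro rfl
      exact ⟨δ_stair'_first (by omega) _,
        fun i hi hi' => δ_stair'_of_row (by omega) (by omega) _ _,
        δ_stair'_last_row (by omega) (by omega) _,
        fun i hi hi' => δ_stair'_of_col (by omega) (by omega) (by omega) _ _⟩
    · rintro ⟨h1, h2, h3, h4⟩
      refine eq_of_δ_eq fun ⟨i, hi⟩ => ?_
      rcases (show (i = 0) ∨
        (1 ≤ i ∧ i ≤ m) ∨
        (i = m + 1) ∨
        (m + 2 ≤ i ∧ i ≤ 2 * m + 2) by omega) with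
        rfl | ⟨h, h'⟩ | rfl | ⟨h, h'⟩
      · exact h1.trans (δ_stair'_first (by omega) _).symm
      · exact (h2 i h h').trans (δ_stair'_of_row (by omega) (by omega) _ _).symm
      · exact h3.trans (δ_stair'_last_row (by omega) (by omega) _).symm
      · exact (h4 i h h').trans (δ_stair'_of_col (by omega) (by omega) (by omega) _ _).symm
  · constructor
    · rintro rfl
      exact ⟨fun i hi => δ_stair_of_row (by omega) _ _,
        δ_stair_last_row (by omega) (by omega) _,
        δ_stair_first (by omega) _,
        fun i hi hi' => δ_stair_of_col (by omega) (by omega) (by omega) _ _⟩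
    · rintro ⟨h1, h2, h3, h4⟩
      refine eq_of_δ_eq fun ⟨i, hi⟩ => ?_
      rcases (show (i ≤ m) ∨
        (i = m + 1) ∨
        (i = m + 2) ∨
        (m + 3 ≤ i ∧ i ≤ 2 * m + 3) by omega) with
        h | rfl | rfl | ⟨h, h'⟩
      · exact (h1 i h).trans (δ_stair_of_row (by omega) _ _).symm
      · exact h2.trans (δ_stair_last_row (by omega) (by omega) _).symm
      · exact h3.trans (δ_stair_first (by omega) _).symm
      · exact (h4 i h h').trans (δ_stair_of_col (by omega) (by omega) (by omega) _ _).symm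
  · constructor
    · rintro rfl
      exact ⟨δ_stair'_first (by omega) _,
        fun i hi hi' => δ_stair'_of_row (by omega) (by omega) _ _,
        fun i hi hi' => δ_stair'_of_col (by omega) (by omega) (by omega) _ _,
        δ_stair'_last_col (by omega) (by omega) _⟩
    · rintro ⟨h1, h2, h3, h4⟩
      refine eq_of_δ_eq fun ⟨i, hi⟩ => ?_
      rcases (show (i = 0) ∨
        (1 ≤ i ∧ i ≤ m + 1) ∨
        (m + 2 ≤ i ∧ i ≤ 2 * m + 2) ∨
        (i = 2 * m + 3) by omega) with
        rfl | ⟨h, h'⟩ | ⟨h, h'⟩ | rfl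
      · exact h1.trans (δ_stair'_first (by omega) _).symm
      · exact (h2 i h h').trans (δ_stair'_of_row (by omega) (by omega) _ _).symm
      · exact (h3 i h h').trans (δ_stair'_of_col (by omega) (by omega) (by omega) _ _).symm
      · exact h4.trans (δ_stair'_last_col (by omega) (by omega) _).symm
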